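/- Let $K\subset\mathbb C$ be a countable (possibly finite) compact set. Let $O(K)$ be the set of functions $f$ that are holomorphic on some open set $V_f\supseteq K$, with the metric $$d(f,g)=\sum_{k=0}^\infty \frac1{2^k}\,\frac{\sup_{z\in K}|f^{(k)}(z)-g^{(k)}(z)|}{1+\sup_{z\in K}|f^{(k)}(z)-g^{(k)}(z)|},$$ where functions at distance $0$ (equivalently, functions that agree on a neighbourhood of $K$) are identified, and let $B(K)$ be the completion of $(O(K),d)$. Let $C(K)$ be the space of continuous functions $K\to\mathbb C$ with the supremum norm $\|\cdot\|_K$, and let $B(K)\to C(K)^{\aleph_0}=\{(g_k)_{k\ge 0}: g_k\in C(K)\}$ be the canonical map, that is, the continuous extension to $B(K)$ of $f\mapsto (f^{(k)}|_K)_{k\ge 0}$, where $C(K)^{\aleph_0}$ has the topology of termwise uniform convergence on $K$. Then $\overline P=B(K)=C(K)^{\aleph_0}$ in the following sense: 1. the set $P$ of polynomials is dense in $B(K)$; 2. the canonical map $B(K)\to C(K)^{\aleph_0}$ is a bijection, and it is isometric: if $b,c\in B(K)$ correspond to $(b_k)$ and $(c_k)$, then their distance in $B(K)$ is $\sum_{k=0}^\infty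 2^{-k}\,\|b_k-c_k\|_K/(1+\|b_k-c_k\|_K)$. -/

import Mathlib

namespace DerivApprox

open TopologicalSpace UniformSpace

/-- The set `O(K)` of functions that are holomorphic on some open set containing `K`. (A function
is represented by a total function on `ℂ`; its values off that open set play no role below.) -/
def O (K : Compacts ℂ) : Type :=
  {f : ℂ → ℂ // ∃ V : Set ℂ, IsOpen V ∧ (K : Set ℂ) ⊆ V ∧ DifferentiableOn ℂ f V}

namespace O

variable {K : Compacts ℂ}

theorem continuousOn_iteratedDeriv (f : O K) (k : ℕ) :
    ContinuousOn (iteratedDeriv k f.1) (K : Set ℂ) := by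
  obtain ⟨V, hV, hKV, hf⟩ := f.2
  have h := (hf.analyticOnNhd hV).iterated_deriv k
  rw [← iteratedDeriv_eq_iterate] at h
  exact h.continuousOn.mono hKV

/-- The sequence `(f, f', f'', …)` of derivatives of `f ∈ O(K)`, restricted to `K`. -/
noncomputable def derivSeq (f : O K) (k : ℕ) : C(K, ℂ) where
  toFun z := iteratedDeriv k f.1 (z : ℂ)
  continuous_toFun := continuousOn_iff_continuous_domRestrict.1 (f.continuousOn_iteratedDeriv k)

/-- The supremum over `z ∈ K` of `|f⁽ᵏ⁾(z) - g⁽ᵏ⁾(z)|`. -/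
noncomputable def supDiff (k : ℕ) (f g : O K) : ℝ :=
  ⨆ z : K, ‖iteratedDeriv k f.1 (z : ℂ) - iteratedDeriv k g.1 (z : ℂ)‖

theorem supDiff_eq_norm (k : ℕ) (f g : O K) : supDiff k f g = ‖f.derivSeq k - g.derivSeq k‖ := by
  rw [ContinuousMap.norm_eq_iSup_norm]; rfl

theorem supDiff_nonneg (k : ℕ) (f g : O K) : 0 ≤ supDiff k f g := by
  rw [supDiff_eq_norm]; positivity

theorem summable_dist {s : ℕ → ℝ} (hs : ∀ k, 0 ≤ s k) :
    Summable fun k : ℕ => 1 / 2 ^ k * (s k / (1 + s k)) := by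
  refine Summable.of_nonneg_of_le (fun k => ?_) (fun k => ?_) summable_geometric_two
  · have := hs k; positivity
  · have := hs k
    rw [div_pow, one_pow]
    refine mul_le_of_le_one_right (by positivity) ?_
    rw [div_le_one (by positivity)]; linarith

/-- `O(K)` with the metric
`d(f, g) = ∑ₖ 2⁻ᵏ · sup_K |f⁽ᵏ⁾ - g⁽ᵏ⁾| / (1 + sup_K |f⁽ᵏ⁾ - g⁽ᵏ⁾|)`.
Functions which agree on a neighbourhood of `K` have distance zero. -/
noncomputable instance : PseudoMetricSpace (O K) where
  dist f g := ∑' k : ℕ, 1 / 2 ^ k * (supDiff k f g / (1 + supDiff k f g))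
  dist_self f := by simp [supDiff]
  dist_comm f g := by simp [supDiff, norm_sub_rev]
  dist_triangle f g h := by
    rw [← (summable_dist fun k => supDiff_nonneg k f g).tsum_add
      (summable_dist fun k => supDiff_nonneg k g h)]
    refine (summable_dist fun k => supDiff_nonneg k f h).tsum_le_tsum (fun k => ?_)
      ((summable_dist fun k => supDiff_nonneg k f g).add
      (summable_dist fun k => supDiff_nonneg k g h))
    rw [← mul_add]
    refine mul_le_mul_of_nonneg_left ?_ (by positivity)
    have h1 := supDiff_nonneg k f g
    have h2 := supDiff_nonneg k g h
    have h3 := supDiff_nonneg k f h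
    have h4 : supDiff k f h ≤ supDiff k f g + supDiff k g h := by
      simpa only [supDiff_eq_norm] using norm_sub_le_norm_sub_add_norm_sub _ _ _
    generalize supDiff k f g = a at *
    generalize supDiff k g h = b at *
    generalize supDiff k f h = c at *
    calc c / (1 + c) ≤ (a + b) / (1 + (a + b)) := by
          rw [div_le_div_iff₀ (by positivity) (by positivity)]; nlinarith
      _ = a / (1 + (a + b)) + b / (1 + (a + b)) := add_div _ _ _
      _ ≤ a / (1 + a) + b / (1 + b) := by gcongr <;> linarith

theorem dist_def (f g : O K) :
    dist f g = ∑' k : ℕ, 1 / 2 ^ k * (supDiff k f g / (1 + supDiff k f g)) := rfl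

theorem uniformContinuous_derivSeq :
    UniformContinuous (derivSeq : O K → ℕ → C(K, ℂ)) := by
  rw [uniformContinuous_pi]
  intro k
  rw [Metric.uniformContinuous_iff]
  intro ε hε
  refine ⟨1 / 2 ^ k * (ε / (1 + ε)), by positivity, fun {f g} hfg => ?_⟩
  have h0 := supDiff_nonneg k f g
  have h1 : 1 / 2 ^ k * (supDiff k f g / (1 + supDiff k f g)) ≤ dist f g :=
    (summable_dist fun k => supDiff_nonneg k f g).le_tsum k
      (fun j _ => by have := supDiff_nonneg j f g; positivity)
  have h2 := lt_of_mul_lt_mul_left (h1.trans_lt hfg) (by positivity)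
  rw [div_lt_div_iff₀ (by positivity) (by positivity)] at h2
  rw [dist_eq_norm, ← supDiff_eq_norm]
  nlinarith

/-- A polynomial, as an element of `O(K)`. -/
noncomputable def ofPolynomial (K : Compacts ℂ) (p : Polynomial ℂ) : O K :=
  ⟨fun z => p.eval z, Set.univ, isOpen_univ, Set.subset_univ _, p.differentiable.differentiableOn⟩

end O

/-- The space `B(K)`: the metric completion of `O(K)` with respect to `d`. -/
abbrev B (K : Compacts ℂ) : Type := Completion (O K)

/-- The canonical map `B(K) → C(K)^ℕ`, through which elements of the completion are regarded as
sequences of continuous functions on `K`: the continuous extension to `B(K)` of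
`f ↦ (f, f', f'', …)`, for the topology of termwise uniform convergence on `K`. -/
noncomputable def toSeq (K : Compacts ℂ) : B K → ℕ → C(K, ℂ) :=
  Completion.extension O.derivSeq

theorem toSeq_coe {K : Compacts ℂ} (f : O K) : toSeq K (f : B K) = f.derivSeq :=
  Completion.extension_coe O.uniformContinuous_derivSeq f

theorem continuous_toSeq (K : Compacts ℂ) : Continuous (toSeq K) :=
  Completion.continuous_extension

/-- The set `P` of polynomials, regarded as a subset of `B(K)`. -/
def polynomials (K : Compacts ℂ) : Set (B K) :=
  Set.range fun p : Polynomial ℂ => (O.ofPolynomial K p : B K)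

end DerivApprox

/-!
Everything reduces to one density statement: for all `n` and `g₀, …, gₙ ∈ C(K)` some polynomial `p`
has `p⁽ᵏ⁾|_K` uniformly close to `gₖ` for every `k ≤ n`.

On the Banach space `C(K)ⁿ⁺¹` consider the bounded operator `T = M_z + D`, where `M_φ` multiplies
each component by `φ ∈ C(K)` and `(D g)ₖ = k gₖ₋₁`. By the Leibniz rule, `p(T)` sends `(1, 0, …, 0)`
to `(p, p', …, p⁽ⁿ⁾)|_K` (`Jet.aeval_one_apply`). Let `S` be the closed algebra of operators generated
by `T`; the claim follows once `S` contains `D` and all `M_φ`, because `M_φ Dᵏ (1, 0, …, 0)` is `k! φ`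
in position `k` and `0` elsewhere.

Since `D` is nilpotent and commutes with the `M_φ`, the resolvent of `T` at `w ∉ K` is the finite sum
`∑ⱼ Dʲ M_{(w - z)⁻ʲ⁻¹}`, so the spectrum of `T` lies in `K`. As `K` is countable, the complement
of the spectrum is connected, and then the spectrum does not grow on passing to `S`: the resolvents
lie in `S` (`mem_of_isPreconnected_compl_spectrum`). Integrating them over a circle that misses `K`
kills all terms with `j ≥ 1` and leaves `2πi` times multiplication by the indicator function of the
disc (`circleIntegral_nilpResolvent`). A countable set is missed by all but countably many circles about a
point, so these indicators separate the points of `K`, and Stone-Weierstrass gives `M_φ ∈ S` for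
every `φ` (`map_mem_of_coord_add_mem`). Finally `D = T - M_z ∈ S`.

Both sides of the distance formula are continuous on `B(K) × B(K)` and agree on `O(K)`, hence they are
equal. So a sequence in `B(K)` converges as soon as its image in `C(K)^ℕ` does, which turns
the density statement into surjectivity of the canonical map and density of the polynomials.
-/

namespace DerivApprox

open scoped Real

/-! ### Circle integrals and spectral permanence -/

theorem circleIntegral_comp_comm {E F : Type*} [NormedAddCommGroup E] [NormedSpace ℂ E]
    [CompleteSpace E] [NormedAddCommGroup F] [NormedSpace ℂ F] [CompleteSpace F] (L : E →L[ℂ] F)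
    {f : ℂ → E} {c : ℂ} {r : ℝ} (hf : CircleIntegrable f c r) :
    (∮ z in C(c, r), L (f z)) = L (∮ z in C(c, r), f z) := by
  simp only [circleIntegral]
  rw [← L.intervalIntegral_comp_comm hf.out]
  simp

theorem circleIntegral_mem {E : Type*} [NormedAddCommGroup E] [NormedSpace ℂ E]
    [CompleteSpace E] {S : Submodule ℂ E} (hS : IsClosed (S : Set E)) {f : ℂ → E} {c : ℂ} {r : ℝ}
    (hr : 0 ≤ r) (hf : CircleIntegrable f c r) (h : ∀ z ∈ Metric.sphere c r, f z ∈ S) :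
    (∮ z in C(c, r), f z) ∈ S := by
  have : IsClosed (S : Set E) := hS
  rw [← Submodule.Quotient.mk_eq_zero, ← Submodule.mkQ_apply]
  have := circleIntegral_comp_comm (S.mkQL) hf
  change _ = S.mkQ _ at this
  rw [← this, circleIntegral.integral_congr (g := fun _ => 0) hr]
  · simp [circleIntegral]
  · intro z hz
    simpa using h z hz

/-- A closed subalgebra containing `a` contains the resolvent of `a` whenever the complement of the
spectrum of `a` is connected: enlarging the algebra can only remove bounded components of the
resolvent set from the spectrum. -/
theorem mem_of_isPreconnected_compl_spectrum {A : Type*} [NormedRing A] [NormedAlgebra ℂ A]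
    [CompleteSpace A] {S : Subalgebra ℂ A} (hS : IsClosed (S : Set A)) {a : A} (ha : a ∈ S)
    (hc : IsPreconnected (spectrum ℂ a)ᶜ) {w : ℂ} {b : A}
    (h₁ : b * (algebraMap ℂ A w - a) = 1) (h₂ : (algebraMap ℂ A w - a) * b = 1) : b ∈ S := by
  have : IsClosed (S : Set A) := hS
  have hw : w ∉ spectrum ℂ a := by
    rw [spectrum.notMem_iff]
    exact ⟨⟨_, b, h₂, h₁⟩, rfl⟩
  rw [← Subalgebra.spectrum_eq_of_isPreconnected_compl S ⟨a, ha⟩ hc, spectrum.notMem_iff] at hw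
  obtain ⟨u, hu⟩ := hw
  have h₃ : (algebraMap ℂ A w - a) * ((↑u⁻¹ : S) : A) = 1 := by
    have := congrArg (Subtype.val) u.mul_inv
    rw [hu] at this
    exact this
  rw [left_inv_eq_right_inv h₁ h₃]
  exact (↑u⁻¹ : S).2

theorem exists_radius_disjoint_sphere {s : Set ℂ} (hs : s.Countable) (x : ℂ) {ε : ℝ} (hε : 0 < ε) :
    ∃ r, 0 < r ∧ r < ε ∧ Disjoint (Metric.sphere x r) s := by
  obtain ⟨r, hr, h0, h1⟩ :=
    (Set.Countable.dense_compl ℝ (hs.image fun z => dist z x)).exists_between hε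
  refine ⟨r, h0, h1, Set.disjoint_left.2 fun z hz hzs => hr ⟨z, hzs, hz⟩⟩

/-! ### The Cauchy kernel as a `C(K)`-valued function -/

section Resolvent

variable (K : TopologicalSpace.Compacts ℂ)

/-- The coordinate function `z ↦ z` in `C(K)`. -/
noncomputable def coord : C(K, ℂ) := ⟨Subtype.val, continuous_subtype_val⟩

variable {K}

theorem isUnit_sub_coord {w : ℂ} (hw : w ∉ (K : Set ℂ)) :
    IsUnit (algebraMap ℂ C(K, ℂ) w - coord K) := by
  rw [ContinuousMap.isUnit_iff_forall_ne_zero]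
  intro z h
  refine hw ?_
  have : w = z := by simpa [coord, sub_eq_zero] using h
  rw [this]; exact z.2

/-- The function `z ↦ (w - z)⁻¹` in `C(K)`, for `w ∉ K`. It is the inverse of `w - z` in the Banach
algebra `C(K)`, with the junk value `0` when `w ∈ K`. -/
noncomputable def cauchyKernel (K : TopologicalSpace.Compacts ℂ) (w : ℂ) : C(K, ℂ) :=
  Ring.inverse (algebraMap ℂ C(K, ℂ) w - coord K)

theorem sub_coord_mul_cauchyKernel {w : ℂ} (hw : w ∉ (K : Set ℂ)) :
    (algebraMap ℂ C(K, ℂ) w - coord K) * cauchyKernel K w = 1 :=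
  Ring.mul_inverse_cancel _ (isUnit_sub_coord hw)

theorem cauchyKernel_apply {w : ℂ} (hw : w ∉ (K : Set ℂ)) (z : K) :
    cauchyKernel K w z = (w - z)⁻¹ := by
  have := congrArg (fun f : C(K, ℂ) => f z) (sub_coord_mul_cauchyKernel hw)
  refine eq_inv_of_mul_eq_one_right ?_
  simpa [coord] using this

theorem continuousOn_cauchyKernel : ContinuousOn (cauchyKernel K) (K : Set ℂ)ᶜ := by
  intro w hw
  obtain ⟨u, hu⟩ := isUnit_sub_coord hw
  refine ContinuousAt.continuousWithinAt ?_
  have h1 : ContinuousAt (Ring.inverse : C(K, ℂ) → C(K, ℂ))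
      (algebraMap ℂ C(K, ℂ) w - coord K) := by
    rw [← hu]; exact NormedRing.inverse_continuousAt u
  have h2 : Continuous fun w : ℂ => algebraMap ℂ C(K, ℂ) w - coord K :=
    (continuous_algebraMap ℂ C(K, ℂ)).sub continuous_const
  exact ContinuousAt.comp (f := fun w : ℂ => algebraMap ℂ C(K, ℂ) w - coord K) h1 h2.continuousAt

theorem circleIntegrable_cauchyKernel_pow {c : ℂ} {r : ℝ} (hr : 0 ≤ r)
    (h : Disjoint (Metric.sphere c r) (K : Set ℂ)) (j : ℕ) :
    CircleIntegrable (fun w => cauchyKernel K w ^ j) c r :=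
  ((continuousOn_cauchyKernel.mono (Set.disjoint_left.1 h)).pow j).circleIntegrable hr

theorem circleIntegral_cauchyKernel_pow_apply {c : ℂ} {r : ℝ} (hr : 0 ≤ r)
    (h : Disjoint (Metric.sphere c r) (K : Set ℂ)) (j : ℕ) (z : K) :
    (∮ w in C(c, r), cauchyKernel K w ^ j) z = ∮ w in C(c, r), (w - z) ^ (-(j : ℤ)) := by
  have := circleIntegral_comp_comm (ContinuousMap.evalCLM ℂ z)
    (circleIntegrable_cauchyKernel_pow hr h j)
  refine this.symm.trans (circleIntegral.integral_congr hr fun w hw => ?_)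
  simp [cauchyKernel_apply (Set.disjoint_left.1 h hw)]

theorem circleIntegral_cauchyKernel_pow_eq_zero {c : ℂ} {r : ℝ} (hr : 0 ≤ r)
    (h : Disjoint (Metric.sphere c r) (K : Set ℂ)) {j : ℕ} (hj : 2 ≤ j) :
    (∮ w in C(c, r), cauchyKernel K w ^ j) = 0 := by
  ext z
  rw [circleIntegral_cauchyKernel_pow_apply hr h,
    circleIntegral.integral_sub_zpow_of_ne (by omega)]
  rfl

theorem circleIntegral_cauchyKernel_apply {c : ℂ} {r : ℝ} (hr : 0 ≤ r)
    (h : Disjoint (Metric.sphere c r) (K : Set ℂ)) (z : K) :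
    (∮ w in C(c, r), cauchyKernel K w) z = if dist (z : ℂ) c < r then 2 * π * Complex.I else 0 := by
  have := circleIntegral_cauchyKernel_pow_apply hr h 1 z
  simp only [pow_one, Nat.cast_one, zpow_neg_one] at this
  rw [this]
  split_ifs with hz
  · exact circleIntegral.integral_sub_inv_of_mem_ball hz
  · have hz' : r < dist (z : ℂ) c :=
      lt_of_le_of_ne (not_lt.1 hz) fun e => Set.disjoint_left.1 h e.symm z.2
    refine Complex.circleIntegral_eq_zero_of_differentiable_on_off_countable hr
      Set.countable_empty ?_ fun w hw => ?_
    · intro w hw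
      refine ContinuousAt.continuousWithinAt (ContinuousAt.inv₀ (by fun_prop) ?_)
      rw [sub_ne_zero]; rintro rfl; exact absurd hz' (not_lt.2 hw)
    · refine DifferentiableAt.inv (by fun_prop) ?_
      rw [sub_ne_zero]; rintro rfl; exact absurd hz' (not_lt.2 (le_of_lt hw.1))

end Resolvent

/-! ### Nilpotent perturbations of a representation of `C(K)` -/

section Abstract

variable {K : TopologicalSpace.Compacts ℂ} {A : Type*} [NormedRing A] [NormedAlgebra ℂ A]
  (m : C(K, ℂ) →ₐ[ℂ] A) (D : A)

/-- The geometric sum that, for `D ^ n = 0` and `D` commuting with the range of `m`, inverts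
`w - (m z + D)`. -/
noncomputable def nilpResolvent (n : ℕ) (w : ℂ) : A :=
  m (cauchyKernel K w) * ∑ j ∈ Finset.range n, (D * m (cauchyKernel K w)) ^ j

variable {m D}

theorem sub_mul_nilpResolvent (hcomm : ∀ φ, Commute D (m φ)) {n : ℕ} (hD : D ^ n = 0)
    {w : ℂ} (hw : w ∉ (K : Set ℂ)) :
    (algebraMap ℂ A w - (m (coord K) + D)) * nilpResolvent m D n w = 1 := by
  have h1 : m (algebraMap ℂ C(K, ℂ) w - coord K) * m (cauchyKernel K w) = 1 := by
    rw [← map_mul, sub_coord_mul_cauchyKernel hw, map_one]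
  have h2 : (algebraMap ℂ A w - (m (coord K) + D)) * m (cauchyKernel K w) =
      1 - D * m (cauchyKernel K w) := by
    rw [← h1, map_sub, AlgHom.commutes]
    noncomm_ring
  rw [nilpResolvent, ← mul_assoc, h2, mul_neg_geom_sum, (hcomm _).mul_pow, hD, zero_mul, sub_zero]

theorem nilpResolvent_mul_sub (hcomm : ∀ φ, Commute D (m φ)) {n : ℕ} (hD : D ^ n = 0)
    {w : ℂ} (hw : w ∉ (K : Set ℂ)) :
    nilpResolvent m D n w * (algebraMap ℂ A w - (m (coord K) + D)) = 1 := by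
  rw [← sub_mul_nilpResolvent hcomm hD hw]
  have hm : ∀ φ ψ, Commute (m φ) (m ψ) := fun φ ψ => (Commute.all φ ψ).map m
  have h1 : ∀ φ, Commute (m φ) (algebraMap ℂ A w - (m (coord K) + D)) := fun φ =>
    Commute.sub_right (Algebra.commutes w (m φ)).symm ((hm _ _).add_right (hcomm φ).symm)
  have h2 : Commute D (algebraMap ℂ A w - (m (coord K) + D)) :=
    Commute.sub_right (Algebra.commutes w D).symm ((hcomm _).add_right (Commute.refl D))
  exact (h1 _).mul_left (Commute.sum_left _ _ _ fun j _ => (h2.mul_left (h1 _)).pow_left j)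

/-- The nilpotent part does not contribute to the contour integral of the resolvent, since
`∮ (w - z)⁻ʲ dw = 0` for `j ≥ 2`. -/
theorem circleIntegral_nilpResolvent [CompleteSpace A] (hm : Continuous m)
    (hcomm : ∀ φ, Commute D (m φ)) {n : ℕ}
    {c : ℂ} {r : ℝ} (hr : 0 ≤ r) (h : Disjoint (Metric.sphere c r) (K : Set ℂ)) :
    (∮ w in C(c, r), nilpResolvent m D (n + 1) w) = m (∮ w in C(c, r), cauchyKernel K w) := by
  let L : ℕ → C(K, ℂ) →L[ℂ] A := fun j =>
    (ContinuousLinearMap.mul ℂ A (D ^ j)).comp ⟨m.toLinearMap, hm⟩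
  have hL : ∀ j φ, L j φ = D ^ j * m φ := fun j φ => rfl
  have h1 : nilpResolvent m D (n + 1) = fun w =>
      ∑ j ∈ Finset.range (n + 1), L j (cauchyKernel K w ^ (j + 1)) := by
    ext w
    rw [nilpResolvent, Finset.mul_sum]
    refine Finset.sum_congr rfl fun j _ => ?_
    rw [hL, (hcomm _).mul_pow, ← mul_assoc, ← ((hcomm _).pow_left j).eq, mul_assoc, map_pow,
      pow_succ']
  have hI := fun j => circleIntegrable_cauchyKernel_pow (K := K) hr h j
  rw [h1, circleIntegral.integral_fun_sum, Finset.sum_range_succ', Finset.sum_eq_zero]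
  · rw [circleIntegral_comp_comm (L 0) (hI _), hL]
    simp
  · intro j _
    rw [circleIntegral_comp_comm _ (hI _), circleIntegral_cauchyKernel_pow_eq_zero hr h (by omega),
      map_zero]
  · intro j _
    exact ((L j).continuous.comp_continuousOn
      ((continuousOn_cauchyKernel.mono (Set.disjoint_left.1 h)).pow (j + 1))).circleIntegrable hr

/-- The semisimple part of `m z + D`, and with it the whole range of `m`, lies in every closed
subalgebra containing `m z + D`. -/
theorem map_mem_of_coord_add_mem [CompleteSpace A] (hK : (K : Set ℂ).Countable) (hm : Continuous m)
    (hcomm : ∀ φ, Commute D (m φ)) (hD : IsNilpotent D) {S : Subalgebra ℂ A}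
    (hS : IsClosed (S : Set A)) (hT : m (coord K) + D ∈ S) (φ : C(K, ℂ)) : m φ ∈ S := by
  obtain ⟨n, hn⟩ := hD
  replace hn : D ^ (n + 1) = 0 := by rw [pow_succ, hn, zero_mul]
  have hσ : spectrum ℂ (m (coord K) + D) ⊆ K := by
    intro w hw
    by_contra hwK
    exact hw ⟨⟨_, _, sub_mul_nilpResolvent hcomm hn hwK, nilpResolvent_mul_sub hcomm hn hwK⟩, rfl⟩
  have hc : IsPreconnected (spectrum ℂ (m (coord K) + D))ᶜ :=
    ((hK.mono hσ).isConnected_compl_of_one_lt_rank (by simp)).isPreconnected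
  have hR : ∀ w ∉ (K : Set ℂ), nilpResolvent m D (n + 1) w ∈ S := fun w hw =>
    mem_of_isPreconnected_compl_spectrum hS hT hc (nilpResolvent_mul_sub hcomm hn hw)
      (sub_mul_nilpResolvent hcomm hn hw)
  have hI : ∀ c r, 0 ≤ r → Disjoint (Metric.sphere c r) (K : Set ℂ) →
      m (∮ w in C(c, r), cauchyKernel K w) ∈ S := by
    intro c r hr h
    rw [← circleIntegral_nilpResolvent (n := n) hm hcomm hr h]
    refine circleIntegral_mem (S := Subalgebra.toSubmodule S) hS hr ?_
      fun w hw => hR w (Set.disjoint_left.1 h hw)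
    refine ContinuousOn.circleIntegrable hr ?_
    have hk := hm.comp_continuousOn (continuousOn_cauchyKernel.mono (Set.disjoint_left.1 h))
    exact hk.mul (continuousOn_finsetSum _ fun j _ => (continuousOn_const.mul hk).pow j)
  -- Idempotents are self-adjoint, so the algebra they generate is closed under conjugation, as the
  -- complex Stone-Weierstrass theorem requires.
  let s : Set C(K, ℂ) := {e | (∀ z, e z = 0 ∨ e z = 1) ∧ m e ∈ S}
  have hs : star s ⊆ s := by
    intro e he
    have : star e = e := by
      have h2 : star (star e) = star e := by
        ext z
        rcases he.1 z with h | h <;> simp only [ContinuousMap.star_apply] at h ⊢ <;> simp [h]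
      rw [star_star] at h2; exact h2.symm
    rw [Set.mem_star, this] at he
    exact he
  have hle : Algebra.adjoin ℂ (s ∪ star s) ≤ S.comap m :=
    Algebra.adjoin_le (Set.union_subset (fun e he => he.2) fun e he => (hs he).2)
  have hsep : (StarAlgebra.adjoin ℂ s).SeparatesPoints := by
    intro x y hxy
    -- The indicator of a disc about `x` that excludes `y`.
    obtain ⟨r, hr0, hr, hd⟩ :=
      exists_radius_disjoint_sphere hK (x : ℂ) (dist_pos.2 (Subtype.coe_ne_coe.2 hxy))
    have hI' := fun z => circleIntegral_cauchyKernel_apply hr0.le hd z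
    have hpi : (2 * π * Complex.I : ℂ) ≠ 0 := Complex.two_pi_I_ne_zero
    refine ⟨_, ⟨(2 * π * Complex.I : ℂ)⁻¹ • (∮ w in C(x, r), cauchyKernel K w),
      StarAlgebra.subset_adjoin ℂ s ⟨fun z => ?_, ?_⟩, rfl⟩, ?_⟩
    · rw [ContinuousMap.smul_apply, hI']
      split_ifs
      · right; exact inv_mul_cancel₀ hpi
      · left; simp
    · rw [map_smul]
      exact S.smul_mem (hI _ _ hr0.le hd) _
    · simp only [ContinuousMap.smul_apply, hI']
      rw [if_pos (by simpa using hr0), if_neg (by rw [dist_comm]; exact not_lt.2 hr.le)]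
      simp [hpi]
  have htop := ContinuousMap.starSubalgebra_topologicalClosure_eq_top_of_separatesPoints _ hsep
  have hφ : φ ∈ closure ((StarAlgebra.adjoin ℂ s : StarSubalgebra ℂ C(K, ℂ)) : Set C(K, ℂ)) := by
    rw [← StarSubalgebra.topologicalClosure_coe, htop]; trivial
  refine (closure_minimal ?_ (hS.preimage hm)) hφ
  intro e he
  exact hle (by rw [← StarAlgebra.adjoin_toSubalgebra]; exact he)

theorem nilpotent_mem_of_coord_add_mem [CompleteSpace A] (hK : (K : Set ℂ).Countable)
    (hm : Continuous m) (hcomm : ∀ φ, Commute D (m φ)) (hD : IsNilpotent D) {S : Subalgebra ℂ A}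
    (hS : IsClosed (S : Set A)) (hT : m (coord K) + D ∈ S) : D ∈ S := by
  have := S.sub_mem hT (map_mem_of_coord_add_mem hK hm hcomm hD hS hT (coord K))
  rwa [add_sub_cancel_left] at this

end Abstract

theorem apply_mem_closure_range_aeval {E : Type*} [NormedAddCommGroup E] [NormedSpace ℂ E]
    (T : E →L[ℂ] E) (v : E) {s : E →L[ℂ] E}
    (hs : s ∈ (Algebra.adjoin ℂ {T}).topologicalClosure) :
    s v ∈ closure (Set.range fun p : Polynomial ℂ => Polynomial.aeval T p v) := by
  have hcont : Continuous fun L : E →L[ℂ] E => L v := by fun_prop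
  refine map_mem_closure (f := fun L : E →L[ℂ] E => L v) hcont hs fun L hL => ?_
  rw [SetLike.mem_coe, Algebra.adjoin_singleton_eq_range_aeval] at hL
  obtain ⟨p, rfl⟩ := hL
  exact ⟨p, rfl⟩

theorem sum_apply_mem_closure_range_aeval {K : TopologicalSpace.Compacts ℂ}
    (hK : (K : Set ℂ).Countable) {E : Type*} [NormedAddCommGroup E] [NormedSpace ℂ E]
    [CompleteSpace E] {m : C(K, ℂ) →ₐ[ℂ] (E →L[ℂ] E)} {D : E →L[ℂ] E} (hm : Continuous m)
    (hcomm : ∀ φ, Commute D (m φ)) (hD : IsNilpotent D) (v : E) {ι : Type*} [Fintype ι]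
    (c : ι → ℂ) (φ : ι → C(K, ℂ)) (j : ι → ℕ) :
    (∑ i, c i • (m (φ i) * D ^ j i)) v ∈
      closure (Set.range fun p : Polynomial ℂ => Polynomial.aeval (m (coord K) + D) p v) := by
  have hT := Subalgebra.le_topologicalClosure _
    (Algebra.self_mem_adjoin_singleton ℂ (m (coord K) + D))
  have hS := Subalgebra.isClosed_topologicalClosure (Algebra.adjoin ℂ {m (coord K) + D})
  exact apply_mem_closure_range_aeval _ v <| Subalgebra.sum_mem _ fun i _ =>
    Subalgebra.smul_mem _ (Subalgebra.mul_mem _ (map_mem_of_coord_add_mem hK hm hcomm hD hS hT _)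
      (Subalgebra.pow_mem _ (nilpotent_mem_of_coord_add_mem hK hm hcomm hD hS hT) _)) _

open Polynomial Filter Topology

/-! ### Jets of polynomials -/

section Jets

variable (K : TopologicalSpace.Compacts ℂ) (n : ℕ)

/-- Candidates `(g₀, …, gₙ)` for the restrictions to `K` of a function and its first `n`
derivatives. The derivatives are not divided by factorials. -/
abbrev Jet : Type := Fin (n + 1) → C(K, ℂ)

/-- Componentwise multiplication by `φ ∈ C(K)`. -/
noncomputable def Jet.mulOp : C(K, ℂ) →ₐ[ℂ] (Jet K n →L[ℂ] Jet K n) :=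
  AlgHom.ofLinearMap (ContinuousLinearMap.lsmul ℂ C(K, ℂ)).toLinearMap
    (by ext; simp) (by intro φ ψ; ext; simp [mul_assoc])

/-- The operator `(D g)ₖ = k gₖ₋₁`, the correction term in the Leibniz rule
`(z f)⁽ᵏ⁾ = z f⁽ᵏ⁾ + k f⁽ᵏ⁻¹⁾`. -/
noncomputable def Jet.shift : Jet K n →L[ℂ] Jet K n :=
  ContinuousLinearMap.pi (Fin.cases 0 fun j : Fin n =>
    ((j : ℂ) + 1) • ContinuousLinearMap.proj j.castSucc)

/-- The jet `(1, 0, …, 0)` of the constant function `1`. -/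
noncomputable def Jet.one : Jet K n := Pi.single 0 1

variable {K n}

namespace Jet

theorem continuous_mulOp : Continuous (mulOp K n) :=
  (ContinuousLinearMap.lsmul ℂ C(K, ℂ)).continuous

@[simp] theorem mulOp_apply (φ : C(K, ℂ)) (g : Jet K n) (k : Fin (n + 1)) :
    mulOp K n φ g k = φ * g k := rfl

@[simp] theorem shift_apply_zero (g : Jet K n) : shift K n g 0 = 0 := rfl

@[simp] theorem shift_apply_succ (g : Jet K n) (j : Fin n) :
    shift K n g j.succ = ((j : ℂ) + 1) • g j.castSucc := rfl

theorem commute_shift_mulOp (φ : C(K, ℂ)) : Commute (shift K n) (mulOp K n φ) := by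
  refine ContinuousLinearMap.ext fun g => funext fun k => ?_
  rw [mul_apply_eq_comp, mul_apply_eq_comp]
  induction k using Fin.cases with
  | zero => simp
  | succ j => simp

theorem shift_pow_apply_eq_zero (g : Jet K n) (j : ℕ) (k : Fin (n + 1)) (h : (k : ℕ) < j) :
    (shift K n ^ j) g k = 0 := by
  induction j generalizing k with
  | zero => omega
  | succ j ih =>
    rw [pow_succ', mul_apply_eq_comp]
    induction k using Fin.cases with
    | zero => simp
    | succ i => rw [shift_apply_succ, ih _ (by simpa using h), smul_zero]

theorem isNilpotent_shift : IsNilpotent (shift K n) :=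
  ⟨n + 1, ContinuousLinearMap.ext fun g => funext fun k => shift_pow_apply_eq_zero g _ k k.2⟩

theorem shift_pow_one_apply (j : ℕ) (k : Fin (n + 1)) :
    (shift K n ^ j) (one K n) k =
      if (k : ℕ) = j then algebraMap ℂ C(K, ℂ) (j.factorial : ℂ) else 0 := by
  induction j generalizing k with
  | zero =>
    induction k using Fin.cases with
    | zero => simp [one]
    | succ i => simp [one]
  | succ j ih =>
    rw [pow_succ', mul_apply_eq_comp]
    induction k using Fin.cases with
    | zero => simp
    | succ i =>
      rw [shift_apply_succ, ih]
      by_cases h : (i : ℕ) = j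
      · ext z; simp [h, Nat.factorial_succ]
      · simp [h]

/-- By the Leibniz rule, multiplication by `z` acts on jets as `M_z + D`, so `p(M_z + D)` maps the
jet of `1` to the jet of `p`. -/
theorem aeval_one_apply (p : ℂ[X]) (k : Fin (n + 1)) (z : K) :
    (aeval (mulOp K n (coord K) + shift K n) p) (one K n) k z =
      (derivative^[k] p).eval (z : ℂ) := by
  induction p using Polynomial.induction_on' generalizing k with
  | add p q hp hq => simp [hp, hq]
  | monomial i a =>
    rw [← C_mul_X_pow_eq_monomial]
    induction i generalizing k with
    | zero =>
      induction k using Fin.cases with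
      | zero => simp [one, Algebra.algebraMap_eq_smul_one]
      | succ j => simp [one, Algebra.algebraMap_eq_smul_one]
    | succ i ih =>
      have hd : ∀ (q : ℂ[X]) (k : ℕ), derivative^[k + 1] (X * q) =
          X * derivative^[k + 1] q + (k + 1 : ℂ[X]) * derivative^[k] q := by
        intro q k
        induction k with
        | zero => simp; ring
        | succ k ihk =>
          rw [Function.iterate_succ_apply', ihk]
          simp only [derivative_add, derivative_mul, derivative_X, derivative_natCast,
            derivative_one, ← Function.iterate_succ_apply' derivative]
          push_cast; ring
      have e : (C a * X ^ (i + 1) : ℂ[X]) = X * (C a * X ^ i) := by ring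
      rw [e, map_mul, aeval_X, mul_apply_eq_comp, _root_.add_apply,
        Pi.add_apply, ContinuousMap.add_apply, mulOp_apply, ContinuousMap.mul_apply, ih]
      induction k using Fin.cases with
      | zero => simp [coord]
      | succ j =>
        rw [shift_apply_succ, ContinuousMap.smul_apply, ih, Fin.val_succ, hd]
        simp [coord]

theorem sum_shift_pow_one (g : Jet K n) :
    (∑ k : Fin (n + 1), ((k : ℕ).factorial : ℂ)⁻¹ • (mulOp K n (g k) * shift K n ^ (k : ℕ)))
      (one K n) = g := by
  funext k
  simp only [_root_.sum_apply, Finset.sum_apply, _root_.smul_apply,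
    Pi.smul_apply, mul_apply_eq_comp, mulOp_apply, shift_pow_one_apply]
  rw [Finset.sum_eq_single k]
  · ext z
    have : ((k : ℕ).factorial : ℂ) ≠ 0 := by exact_mod_cast Nat.factorial_ne_zero _
    simp
    field_simp
  · intro j _ hj
    rw [if_neg (fun h => hj (Fin.ext h.symm))]; simp
  · simp

theorem mem_closure_range_aeval_one (hK : (K : Set ℂ).Countable) (g : Jet K n) :
    g ∈ closure (Set.range fun p : ℂ[X] =>
      (aeval (mulOp K n (coord K) + shift K n) p) (one K n)) := by
  have := sum_apply_mem_closure_range_aeval hK (E := Jet K n) (m := mulOp K n) (D := shift K n)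
    continuous_mulOp commute_shift_mulOp isNilpotent_shift (one K n)
    (fun k : Fin (n + 1) => ((k : ℕ).factorial : ℂ)⁻¹) g (fun k => (k : ℕ))
  rwa [sum_shift_pow_one] at this

end Jet

end Jets

variable {K : TopologicalSpace.Compacts ℂ}

theorem derivSeq_ofPolynomial_apply (p : ℂ[X]) (k : ℕ) (z : K) :
    (O.ofPolynomial K p).derivSeq k z = (derivative^[k] p).eval (z : ℂ) := by
  change iteratedDeriv k (fun z => p.eval z) (z : ℂ) = _
  have : ∀ k, iteratedDeriv k (fun z => p.eval z) = fun z => (derivative^[k] p).eval z := by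
    intro k
    induction k with
    | zero => simp
    | succ k ih =>
      rw [iteratedDeriv_succ, ih, Function.iterate_succ_apply']
      ext z; exact Polynomial.deriv _
  rw [this]

theorem exists_tendsto_derivSeq_ofPolynomial (hK : (K : Set ℂ).Countable) (g : ℕ → C(K, ℂ)) :
    ∃ p : ℕ → ℂ[X], Tendsto (fun n => (O.ofPolynomial K (p n)).derivSeq) atTop (𝓝 g) := by
  have h : ∀ n : ℕ, ∃ p : ℂ[X], ∀ k ≤ n,
      dist ((O.ofPolynomial K p).derivSeq k) (g k) < 1 / ((n : ℝ) + 1) := by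
    intro n
    obtain ⟨_, ⟨p, rfl⟩, hp⟩ := Metric.mem_closure_iff.1
      (Jet.mem_closure_range_aeval_one hK fun k : Fin (n + 1) => g k)
      (1 / ((n : ℝ) + 1)) Nat.one_div_pos_of_nat
    refine ⟨p, fun k hk => lt_of_le_of_lt ?_ hp⟩
    have he : (O.ofPolynomial K p).derivSeq k = (aeval (Jet.mulOp K n (coord K) +
        Jet.shift K n) p) (Jet.one K n) ⟨k, Nat.lt_succ_of_le hk⟩ := by
      ext z
      rw [derivSeq_ofPolynomial_apply, Jet.aeval_one_apply]
    rw [he, dist_comm]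
    exact dist_le_pi_dist (fun k : Fin (n + 1) => g k) _ ⟨k, Nat.lt_succ_of_le hk⟩
  choose p hp using h
  refine ⟨p, tendsto_pi_nhds.2 fun k => ?_⟩
  rw [tendsto_iff_dist_tendsto_zero]
  refine squeeze_zero' (Eventually.of_forall fun _ => dist_nonneg) ?_
    tendsto_one_div_add_atTop_nhds_zero_nat
  filter_upwards [eventually_ge_atTop k] with n hn using (hp n k hn).le

open UniformSpace

/-! ### The metric of the completion -/

/-- The distance on `C(K)^ℕ` that corresponds to the metric of `B(K)`. -/
noncomputable def seqDist (x y : ℕ → C(K, ℂ)) : ℝ :=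
  ∑' k : ℕ, (1 : ℝ) / 2 ^ k * (‖x k - y k‖ / (1 + ‖x k - y k‖))

theorem seqDist_self (x : ℕ → C(K, ℂ)) : seqDist x x = 0 := by simp [seqDist]

theorem continuous_seqDist :
    Continuous fun q : (ℕ → C(K, ℂ)) × (ℕ → C(K, ℂ)) => seqDist q.1 q.2 := by
  refine continuous_tsum (u := fun k => (1 / 2 : ℝ) ^ k) (fun k => ?_) summable_geometric_two ?_
  · refine continuous_const.mul (Continuous.div (by fun_prop) (by fun_prop) fun q => ?_)
    positivity
  · intro k q
    rw [Real.norm_of_nonneg (by positivity), div_pow, one_pow]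
    refine mul_le_of_le_one_right (by positivity) ?_
    rw [div_le_one (by positivity)]; linarith

theorem tendsto_seqDist {ι : Type*} {l : Filter ι} {x y : ι → ℕ → C(K, ℂ)} {a b : ℕ → C(K, ℂ)}
    (hx : Tendsto x l (𝓝 a)) (hy : Tendsto y l (𝓝 b)) :
    Tendsto (fun i => seqDist (x i) (y i)) l (𝓝 (seqDist a b)) :=
  Tendsto.comp (g := fun q : (ℕ → C(K, ℂ)) × (ℕ → C(K, ℂ)) => seqDist q.1 q.2)
    (f := fun i => (x i, y i)) (continuous_seqDist.tendsto (a, b)) (hx.prodMk_nhds hy)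

theorem continuous_seqDist_toSeq :
    Continuous fun q : B K × B K => seqDist (toSeq K q.1) (toSeq K q.2) :=
  continuous_iff_continuousAt.2 fun q =>
    tendsto_seqDist (x := fun q : B K × B K => toSeq K q.1) (y := fun q : B K × B K => toSeq K q.2)
      (((continuous_toSeq K).comp continuous_fst).tendsto q)
      (((continuous_toSeq K).comp continuous_snd).tendsto q)

theorem dist_eq_seqDist (b c : B K) : dist b c = seqDist (toSeq K b) (toSeq K c) := by
  induction b, c using Completion.induction_on₂ with
  | hp => exact isClosed_eq continuous_dist continuous_seqDist_toSeq
  | ih f g =>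
    rw [Completion.dist_eq, O.dist_def, toSeq_coe, toSeq_coe]
    simp only [O.supDiff_eq_norm, seqDist]

theorem tendsto_of_tendsto_toSeq {u : ℕ → B K} {b : B K}
    (h : Tendsto (fun n => toSeq K (u n)) atTop (𝓝 (toSeq K b))) : Tendsto u atTop (𝓝 b) := by
  have := tendsto_seqDist h (tendsto_const_nhds (x := toSeq K b))
  rw [seqDist_self] at this
  simp only [← dist_eq_seqDist] at this
  exact tendsto_iff_dist_tendsto_zero.2 this

theorem exists_toSeq_eq_of_tendsto {u : ℕ → B K} {g : ℕ → C(K, ℂ)}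
    (h : Tendsto (fun n => toSeq K (u n)) atTop (𝓝 g)) : ∃ b, toSeq K b = g := by
  have hu : CauchySeq u := by
    rw [cauchySeq_iff_tendsto_dist_atTop_0, ← prod_atTop_atTop_eq]
    have := tendsto_seqDist (h.comp tendsto_fst) (h.comp (tendsto_snd (f := (atTop : Filter ℕ))))
    rw [seqDist_self] at this
    simp only [Function.comp_apply, ← dist_eq_seqDist] at this
    exact this
  obtain ⟨b, hb⟩ := cauchySeq_tendsto_of_complete hu
  exact ⟨b, tendsto_nhds_unique (((continuous_toSeq K).tendsto b).comp hb) h⟩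

end DerivApprox

open Filter Topology in
theorem corollary4p2 (K : TopologicalSpace.Compacts ℂ) (hK : (K : Set ℂ).Countable) :
    closure (DerivApprox.polynomials K) = Set.univ ∧
    Function.Bijective (DerivApprox.toSeq K) ∧
    ∀ b c : DerivApprox.B K, dist b c =
      ∑' k : ℕ, (1 : ℝ) / 2 ^ k *
        (‖DerivApprox.toSeq K b k - DerivApprox.toSeq K c k‖ /
          (1 + ‖DerivApprox.toSeq K b k - DerivApprox.toSeq K c k‖)) := by
  refine ⟨Set.eq_univ_of_forall fun b => ?_, ⟨fun b c h => ?_, fun g => ?_⟩,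
    DerivApprox.dist_eq_seqDist⟩
  · obtain ⟨p, hp⟩ := DerivApprox.exists_tendsto_derivSeq_ofPolynomial hK (DerivApprox.toSeq K b)
    simp only [← DerivApprox.toSeq_coe] at hp
    exact mem_closure_of_tendsto (DerivApprox.tendsto_of_tendsto_toSeq hp)
      (.of_forall fun n => ⟨p n, rfl⟩)
  · rw [← dist_eq_zero, DerivApprox.dist_eq_seqDist, h, DerivApprox.seqDist_self]
  · obtain ⟨p, hp⟩ := DerivApprox.exists_tendsto_derivSeq_ofPolynomial hK g
    simp only [← DerivApprox.toSeq_coe] at hp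
    exact DerivApprox.exists_toSeq_eq_of_tendsto hp
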